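/- Let $d\ge 2$. In bond percolation on $\mathbb{Z}^d$ with parameter $p\in[0,1]$ each nearest-neighbour edge $e$ is open with probability $p$, independently of the others, and closed otherwise; $\mathbb{P}_p$ is the corresponding product measure. Let $\widehat{\mathbb{Z}}^d=\mathbb{Z}^d+(\tfrac12,\dots,\tfrac12)$. A $k$-facet of $\mathbb{Z}^d$ is a set $x+(A_1\times\dots\times A_d)$ with $x\in\mathbb{Z}^d$, where $k$ of the $A_i$ equal $\{0,1\}$ and the others equal $\{0\}$; $k$-facets of $\widehat{\mathbb{Z}}^d$ are the translates of these by $(\tfrac12,\dots,\tfrac12)$. Two facets of different dimensions are incident if one is a subset of the other. A plaquette is a $(d-1)$-facet of $\widehat{\mathbb{Z}}^d$; the plaquette $\pi(e)$ dual to an edge $e$ is the one with the same centre of mass, and $\pi(e)$ is called open if and only if $e$ is closed. Two plaquettes are adjacent if some $(d-2)$-facet of $\widehat{\mathbb{Z}}^d$ is incident to both. A surface is a set of plaquettes that is connected under this adjacency relation and such that every $(d-2)$-facet of $\widehat{\mathbb{Z}}^d$ is incident to an even number of its elements. Let $p_{\mathrm{surf}}=p_{\mathrm{surf}}(d)\in[0,1]$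 be the critical probability such that, $\mathbb{P}_p$-almost surely, there exists an infinite surface of open plaquettes if $p<p_{\mathrm{surf}}$, and there exists none if $p>p_{\mathrm{surf}}$; that is, $p_{\mathrm{surf}}$ is the supremum of the $p\in[0,1]$ for which an infinite surface of open plaquettes exists $\mathbb{P}_p$-almost surely. For a vertex $v\in\mathbb{Z}^d$, call the cube $v+\{-\tfrac12,\tfrac12\}^d$ good if each of its $2d$ incident plaquettes is open. An infinite oriented path is a sequence $v_0,v_1,\dots$ in $\mathbb{Z}^d$ such that each $v_{n+1}-v_n$ is one of the $d$ positive coordinate unit vectors. For $A\subseteq\mathbb{Z}^d$ let $\Pi(A)$ be the set of plaquettes $\pi(e)$ over all edges $e=\langle x,y\rangle$ with $x\in A$, $y\notin A$, such that $y$ lies in some infinite path of the lattice (with distinct vertices) that does not intersect $A$. Then: 1. $p_{\mathrm{surf}}(d)>0$. 2. There exists $p'=p'(d)>0$ such that, for every $p\in[0,1]$ with $p<p'$, $\mathbb{P}_p$-almost surely there is an infinite oriented path $v_0,v_1,\dots$ for which all the cubes $v_n+\{-\tfrac12,\tfrac12\}^d$ are good and, with $V=\{v_0,v_1,\dots\}$,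 the set $\Pi(V)$ is an infinite surface all of whose plaquettes are open. -/

import Mathlib

open MeasureTheory ProbabilityTheory unitInterval

namespace PlaquettePercolation

/-- A facet `x + (A₁ × ⋯ × A_d)` of `ℤ^d`: `base` is `x`, and `dirs` is the set of the
coordinates `i` with `A_i = {0, 1}` (the others have `A_i = {0}`).

Facets of the shifted lattice `ℤ^d + h`, `h = (1/2, …, 1/2)`, are by definition the sets `F + h`
with `F` a facet of `ℤ^d`; such a facet is represented by `F`. Inclusions between facets of
`ℤ^d + h` are the same as inclusions between the facets of `ℤ^d` that represent them. -/
@[ext]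
structure Facet (d : ℕ) where
  base : Fin d → ℤ
  dirs : Finset (Fin d)

namespace Facet

variable {d : ℕ}

/-- The facet as a subset of `ℤ^d`. -/
def points (F : Facet d) : Set (Fin d → ℤ) :=
  {y | ∀ i, y i = F.base i ∨ (i ∈ F.dirs ∧ y i = F.base i + 1)}

/-- The dimension of a facet. -/
def dim (F : Facet d) : ℕ := F.dirs.card

/-- Two facets of different dimensions are incident if one is a subset of the other. -/
def Incident (F G : Facet d) : Prop :=
  F.dim ≠ G.dim ∧ (F.points ⊆ G.points ∨ G.points ⊆ F.points)

/-- The dual of a facet of `ℤ^d`: the facet of `ℤ^d + h` with the same centre of mass. In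
`F = x + (A₁ × ⋯ × A_d)` each `{0, 1}` is replaced by `{1/2}`, and each `{0}` by `{-1/2, 1/2}`;
translating by `-h`, the former becomes `{0}` and the latter `{-1, 0}`. -/
def dual (F : Facet d) : Facet d where
  base := fun i => if i ∈ F.dirs then F.base i else F.base i - 1
  dirs := F.dirsᶜ

/-- A facet is determined by its set of points. -/
theorem points_injective : Function.Injective (points : Facet d → Set (Fin d → ℤ)) := by
  have key : ∀ F G : Facet d, F.points ⊆ G.points →
      (∀ i, G.base i ≤ F.base i) ∧
        ∀ i ∈ F.dirs, i ∈ G.dirs ∧ F.base i = G.base i := by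
    intro F G h
    have hb : F.base ∈ G.points := h fun i => Or.inl rfl
    refine ⟨fun i => ?_, fun i hi => ?_⟩
    · rcases hb i with h1 | h1 <;> omega
    · have h2 : Function.update F.base i (F.base i + 1) ∈ G.points := by
        refine h fun j => ?_
        by_cases hj : j = i
        · subst hj
          exact Or.inr ⟨hi, by simp⟩
        · exact Or.inl (by simp [hj])
      have h3 := h2 i
      simp only [Function.update_self] at h3
      rcases hb i with h1 | ⟨h4, h1⟩ <;> rcases h3 with h3 | ⟨h5, h3⟩ <;>
        first
          | omega
          | exact ⟨h5, by omega⟩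
  intro F G h
  have h1 := key F G h.le
  have h2 := key G F h.ge
  ext i
  · exact le_antisymm (h2.1 i) (h1.1 i)
  · exact ⟨fun hi => (h1.2 i hi).1, fun hi => (h2.2 i hi).1⟩

/-- The points of the dual facet, in the coordinates of `ℤ^d + h`. -/
theorem mem_points_dual (F : Facet d) (y : Fin d → ℤ) :
    y ∈ F.dual.points ↔ ∀ i,
      (i ∈ F.dirs → (y i + 1 / 2 : ℚ) = F.base i + 1 / 2) ∧
      (i ∉ F.dirs →
        (y i + 1 / 2 : ℚ) = F.base i - 1 / 2 ∨ (y i + 1 / 2 : ℚ) = F.base i + 1 / 2) := by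
  refine forall_congr' fun i => ?_
  by_cases hi : i ∈ F.dirs
  · simp [dual, hi]
  · have h1 : (y i + 1 / 2 : ℚ) = F.base i - 1 / 2 ↔ y i = F.base i - 1 := by
      rw [← @Int.cast_inj ℚ]
      push_cast
      constructor <;> intro h <;> linarith
    simp only [dual, hi, h1, Finset.mem_compl, if_false, not_false_eq_true, true_and,
      false_imp_iff, true_imp_iff, add_left_inj, Int.cast_inj, sub_add_cancel]

end Facet

/-- Edges of the lattice: the 1-facets of `ℤ^d`. -/
abbrev Edge (d : ℕ) : Type := {F : Facet d // F.dim = 1}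

/-- Plaquettes of the shifted lattice `ℤ^d + h`: its `(d-1)`-facets. -/
abbrev Plaquette (d : ℕ) : Type := {F : Facet d // F.dim + 1 = d}

/-- The `(d-2)`-facets of the shifted lattice `ℤ^d + h`. -/
abbrev Ridge (d : ℕ) : Type := {F : Facet d // F.dim + 2 = d}

variable {d : ℕ}

/-- The plaquette `π(e)` dual to the edge `e`. -/
def Edge.plaquette (e : Edge d) : Plaquette d :=
  ⟨e.1.dual, by
    have h := e.2
    have h2 := Finset.card_le_univ e.1.dirs
    simp only [Facet.dim, Facet.dual, Finset.card_compl, Fintype.card_fin] at *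
    omega⟩

/-- `x` and `y` are neighbours in the hypercubic lattice. -/
def LatticeAdj (x y : Fin d → ℤ) : Prop := ∃ e : Edge d, e.1.points = {x, y}

/-- Adjacency of plaquettes: some `(d-2)`-facet is incident to both. -/
def plaquetteGraph (d : ℕ) : SimpleGraph (Plaquette d) where
  Adj π₁ π₂ := π₁ ≠ π₂ ∧ ∃ f : Ridge d, f.1.Incident π₁.1 ∧ f.1.Incident π₂.1
  symm := ⟨fun _ _ h => ⟨h.1.symm, h.2.imp fun _ hf => hf.symm⟩⟩
  loopless := ⟨fun _ h => h.1 rfl⟩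

/-- The boundary of a set of plaquettes: the `(d-2)`-facets that are incident to an odd number of
its elements. -/
def boundary (P : Set (Plaquette d)) : Set (Ridge d) :=
  {f | Odd {π ∈ P | f.1.Incident π.1}.ncard}

/-- A surface: a connected set of plaquettes with empty boundary. -/
def IsSurface (P : Set (Plaquette d)) : Prop :=
  ((plaquetteGraph d).induce P).Connected ∧ boundary P = ∅

/-- Bond configurations: `ω e = true` if the edge `e` is open, `ω e = false` if it is closed. -/
abbrev Config (d : ℕ) : Type := Edge d → Bool

/-- The plaquette `π(e)` is open if the edge `e` is closed. -/
def PlaquetteOpen (ω : Config d) (π : Plaquette d) : Prop :=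
  ∃ e : Edge d, e.plaquette = π ∧ ω e = false

/-- Product measure: the edges are open independently, each with probability `p`. -/
noncomputable def bondMeasure (d : ℕ) (p : I) : Measure (Config d) :=
  Measure.infinitePi fun _ : Edge d => bernoulliMeasure true false p

instance (d : ℕ) (p : I) : IsProbabilityMeasure (bondMeasure d p) := by
  unfold bondMeasure
  infer_instance

/-- The event that there is an infinite open surface. -/
def surfaceEvent (d : ℕ) : Set (Config d) :=
  {ω | ∃ P : Set (Plaquette d), IsSurface P ∧ P.Infinite ∧ ∀ π ∈ P, PlaquetteOpen ω π}

/-- The critical probability for the existence of an infinite open surface, as an element of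
`[0, 1]`. -/
noncomputable def psurf (d : ℕ) : I :=
  sSup {p : I | ∀ᵐ ω ∂(bondMeasure d p), ω ∈ surfaceEvent d}

/-- A point below which an infinite open surface exists almost surely, and above which almost
surely there is none, is `psurf d`. -/
theorem eq_psurf_of_threshold (d : ℕ) (q : I)
    (h1 : ∀ p < q, ∀ᵐ ω ∂(bondMeasure d p), ω ∈ surfaceEvent d)
    (h0 : ∀ p > q, ∀ᵐ ω ∂(bondMeasure d p), ω ∉ surfaceEvent d) :
    q = psurf d := by
  apply le_antisymm
  · exact le_of_forall_lt_imp_le_of_dense fun p hp => le_sSup (h1 p hp)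
  · refine sSup_le fun p hp => ?_
    by_contra hlt
    have h : ∀ᵐ _ ∂(bondMeasure d p), False := by
      filter_upwards [hp, h0 p (not_le.mp hlt)] with ω ha hb using hb ha
    simp at h
    exact IsProbabilityMeasure.ne_zero _ h

/-- The external boundary of `A`: the vertices outside `A` that are adjacent to some element of `A`
and lie in some infinite path of the lattice not intersecting `A`. -/
def externalBoundary (A : Set (Fin d → ℤ)) : Set (Fin d → ℤ) :=
  {y | y ∉ A ∧ (∃ x ∈ A, LatticeAdj x y) ∧
    ∃ γ : ℕ → Fin d → ℤ, Function.Injective γ ∧ (∀ n, LatticeAdj (γ n) (γ (n + 1))) ∧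
      y ∈ Set.range γ ∧ ∀ n, γ n ∉ A}

/-- The set `Π(A)` of the plaquettes dual to edges with one endvertex in `A` and the other in the
external boundary of `A`. -/
def boundaryPlaquettes (A : Set (Fin d → ℤ)) : Set (Plaquette d) :=
  {π | ∃ e : Edge d, e.plaquette = π ∧
    ∃ x ∈ A, ∃ y ∈ externalBoundary A, e.1.points = {x, y}}

/-- The `d`-facet `v + {-1/2, 1/2}^d` of the shifted lattice, dual to the vertex `v`. -/
def cubeAt (v : Fin d → ℤ) : Facet d := Facet.dual ⟨v, ∅⟩

/-- A `d`-facet of the shifted lattice is good if all its incident plaquettes are open. -/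
def Good (ω : Config d) (B : Facet d) : Prop :=
  ∀ π : Plaquette d, B.Incident π.1 → PlaquetteOpen ω π

/-- An infinite oriented path: each step adds a unit vector in a positive coordinate direction. -/
def IsOrientedPath (v : ℕ → Fin d → ℤ) : Prop :=
  ∀ n, ∃ i : Fin d, v (n + 1) = v n + Pi.single i 1

end PlaquettePercolation

/-! Geometry. For an oriented path with vertex set `V`, every vertex off `V` escapes to infinity
along a ray, so `Π(V)` is dual to the whole edge cut of `V` (`boundaryPlaquettes_eq`). Ridges are
dual to squares, and a 4-cycle crosses a cut an even number of times, so the boundary is empty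
(`boundary_cutPlaquettes`). Connectedness is an induction along the path
(`connected_cutPlaquettes`). If the cubes on `V` are good, all these plaquettes are open.

Probability. It remains to find an oriented path of good cubes, and one coordinate plane suffices.
There, grow the half plane `y ≤ x` by free steps right and down and by steps `(-1, 1)` into bad
sites. If the region misses some `(-n, n)`, its border contains an oriented path of good sites
(`exists_staircase`). A Peierls estimate shows that `(-n, n)` is reached with probability at most `2
* (1/2)^n` (`bondMeasure_reach_le`): a self-avoiding walk of length `N` from `(-n, n)` back to the
half plane has `N ≥ n` and at least `N/3` distinct bad sites, hence at least `N/6` distinct open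
edges, while there are only `3^N` words. -/

namespace PlaquettePercolation

/-! ### Inclusion and duality of facets -/

namespace Facet

variable {d : ℕ}

/-- Inclusion of facets in terms of base points and directions. -/
theorem points_subset_iff (F G : Facet d) :
    F.points ⊆ G.points ↔ ∀ i, (i ∈ F.dirs → i ∈ G.dirs ∧ F.base i = G.base i) ∧
      (F.base i = G.base i ∨ i ∈ G.dirs ∧ F.base i = G.base i + 1) := by
  constructor
  · intro h i
    have hb : F.base ∈ G.points := h fun i => Or.inl rfl
    refine ⟨fun hi => ?_, hb i⟩
    have h2 : Function.update F.base i (F.base i + 1) ∈ G.points := by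
      refine h fun j => ?_
      by_cases hj : j = i
      · subst hj
        exact Or.inr ⟨hi, by simp⟩
      · exact Or.inl (by simp [hj])
    have h3 := h2 i
    simp only [Function.update_self] at h3
    rcases hb i with h1 | ⟨h4, h1⟩ <;> rcases h3 with h3 | ⟨h5, h3⟩ <;>
      first
        | omega
        | exact ⟨h5, by omega⟩
  · intro h y hy i
    have h1 := h i
    rcases hy i with h2 | ⟨h2, h3⟩
    · rcases h1.2 with h3 | ⟨h3, h4⟩
      · exact Or.inl (by omega)
      · exact Or.inr ⟨h3, by omega⟩
    · have := h1.1 h2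
      exact Or.inr ⟨this.1, by omega⟩

theorem dim_le_of_points_subset {F G : Facet d} (h : F.points ⊆ G.points) : F.dim ≤ G.dim :=
  Finset.card_le_card fun i hi => (((points_subset_iff F G).1 h i).1 hi).1

/-- Duality reverses inclusions. -/
theorem dual_subset_dual_iff (F G : Facet d) :
    G.dual.points ⊆ F.dual.points ↔ F.points ⊆ G.points := by
  rw [points_subset_iff, points_subset_iff]
  refine forall_congr' fun i => ?_
  by_cases hF : i ∈ F.dirs <;> by_cases hG : i ∈ G.dirs <;> simp [dual, hF, hG] <;> omega

theorem dual_injective : Function.Injective (dual : Facet d → Facet d) := by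
  intro F G h
  apply points_injective
  exact Set.Subset.antisymm ((dual_subset_dual_iff F G).1 (by rw [h]))
    ((dual_subset_dual_iff G F).1 (by rw [h]))

theorem dual_surjective : Function.Surjective (dual : Facet d → Facet d) := by
  intro F
  refine ⟨⟨fun i => if i ∈ F.dirs then F.base i + 1 else F.base i, F.dirsᶜ⟩, ?_⟩
  ext i
  · by_cases h : i ∈ F.dirs <;> simp [dual, h]
  · simp [dual]

theorem dim_dual_add_dim (F : Facet d) : F.dual.dim + F.dim = d := by
  have h2 := Finset.card_le_univ F.dirs
  simp only [dim, dual, Finset.card_compl, Fintype.card_fin] at *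
  omega

/-- Incidence of dual facets, the second one being dual to a facet of smaller dimension. -/
theorem incident_dual_iff {F G : Facet d} (h : F.dim < G.dim) :
    G.dual.Incident F.dual ↔ F.points ⊆ G.points := by
  have h1 := F.dim_dual_add_dim
  have h2 := G.dim_dual_add_dim
  rw [← dual_subset_dual_iff]
  constructor
  · rintro ⟨_, h3 | h3⟩
    · exact h3
    · have := dim_le_of_points_subset h3
      omega
  · exact fun h3 => ⟨by omega, Or.inl h3⟩

theorem incident_dual_iff' {F G : Facet d} (h : G.dim < F.dim) :
    G.dual.Incident F.dual ↔ G.points ⊆ F.points := by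
  have h1 := F.dim_dual_add_dim
  have h2 := G.dim_dual_add_dim
  rw [← dual_subset_dual_iff]
  constructor
  · rintro ⟨_, h3 | h3⟩
    · have := dim_le_of_points_subset h3
      omega
    · exact h3
  · exact fun h3 => ⟨by omega, Or.inr h3⟩

end Facet

/-! ### Edges, squares and their duals -/

variable {d : ℕ}

/-- The coordinate unit vector. -/
abbrev unitVec (i : Fin d) : Fin d → ℤ := Pi.single i 1

/-- The edge from `x` to `x + unitVec i`. -/
def edgeAt (x : Fin d → ℤ) (i : Fin d) : Edge d := ⟨⟨x, {i}⟩, by simp [Facet.dim]⟩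

theorem exists_eq_edgeAt (e : Edge d) : ∃ x i, e = edgeAt x i := by
  obtain ⟨⟨x, D⟩, h⟩ := e
  obtain ⟨i, rfl⟩ := Finset.card_eq_one.1 h
  exact ⟨x, i, rfl⟩

theorem points_edgeAt (x : Fin d → ℤ) (i : Fin d) :
    (edgeAt x i).1.points = {x, x + unitVec i} := by
  ext y
  simp only [Facet.points, edgeAt, Finset.mem_singleton, Set.mem_ofPred_eq, Set.mem_insert_iff,
    Set.mem_singleton_iff]
  constructor
  · intro h
    rcases h i with h1 | ⟨-, h1⟩
    · left
      ext j
      rcases h j with h2 | ⟨rfl, h2⟩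
      · exact h2
      · exact h1
    · right
      ext j
      by_cases hj : j = i
      · subst hj; simpa using h1
      · rcases h j with h2 | ⟨h3, _⟩
        · simp [hj, h2]
        · exact absurd h3 hj
  · rintro (rfl | rfl) j
    · exact Or.inl rfl
    · by_cases hj : j = i
      · subst hj; simp
      · simp [hj]

theorem latticeAdj_iff (x y : Fin d → ℤ) :
    LatticeAdj x y ↔ ∃ i, y = x + unitVec i ∨ x = y + unitVec i := by
  constructor
  · rintro ⟨e, he⟩
    obtain ⟨z, i, rfl⟩ := exists_eq_edgeAt e
    rw [points_edgeAt, Set.pair_eq_pair_iff] at he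
    refine ⟨i, ?_⟩
    rcases he with ⟨rfl, rfl⟩ | ⟨rfl, rfl⟩
    · exact Or.inl rfl
    · exact Or.inr rfl
  · rintro ⟨i, rfl | rfl⟩
    · exact ⟨edgeAt x i, points_edgeAt x i⟩
    · exact ⟨edgeAt y i, by rw [points_edgeAt, Set.pair_comm]⟩

theorem plaquette_injective : Function.Injective (Edge.plaquette : Edge d → Plaquette d) := by
  intro e e' h
  exact Subtype.ext (Facet.dual_injective (congrArg Subtype.val h))

theorem plaquette_surjective : Function.Surjective (Edge.plaquette : Edge d → Plaquette d) := by
  rintro ⟨F, hF⟩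
  obtain ⟨G, rfl⟩ := Facet.dual_surjective F
  have := G.dim_dual_add_dim
  exact ⟨⟨G, by omega⟩, rfl⟩

/-- The square spanned by two coordinate directions. -/
def squareAt (z : Fin d → ℤ) (i j : Fin d) : Facet d := ⟨z, {i, j}⟩

theorem dim_squareAt (z : Fin d → ℤ) {i j : Fin d} (hij : i ≠ j) : (squareAt z i j).dim = 2 :=
  Finset.card_pair hij

theorem exists_eq_dual_squareAt (f : Ridge d) :
    ∃ z i j, i ≠ j ∧ f.1 = (squareAt z i j).dual := by
  obtain ⟨f, hf⟩ := f
  obtain ⟨⟨z, D⟩, rfl⟩ := Facet.dual_surjective f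
  have := Facet.dim_dual_add_dim ⟨z, D⟩
  have h2 : D.card = 2 := by simp only [Facet.dim] at *; omega
  obtain ⟨i, j, hij, rfl⟩ := Finset.card_eq_two.1 h2
  exact ⟨z, i, j, hij, rfl⟩

/-- This lists the four edges of a square; all incidence and adjacency of plaquettes is reduced to
it. -/
theorem edgeAt_subset_squareAt_iff (x z : Fin d → ℤ) {i j : Fin d} (hij : i ≠ j) (k : Fin d) :
    (edgeAt x k).1.points ⊆ (squareAt z i j).points ↔
      (k = i ∧ (x = z ∨ x = z + unitVec j)) ∨ (k = j ∧ (x = z ∨ x = z + unitVec i)) := by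
  rw [Facet.points_subset_iff]
  simp only [edgeAt, squareAt, Finset.mem_singleton, Finset.mem_insert]
  constructor
  · intro h
    have aux : ∀ a b : Fin d, a ≠ b → k = a →
        (∀ l, (l = k → (l = a ∨ l = b) ∧ x l = z l) ∧
          (x l = z l ∨ (l = a ∨ l = b) ∧ x l = z l + 1)) →
        (x = z ∨ x = z + unitVec b) := by
      rintro a b hab rfl h
      rcases (h b).2 with h1 | ⟨-, h1⟩
      · left
        ext l
        rcases (h l).2 with h2 | ⟨rfl | rfl, h2⟩
        · exact h2
        · exact ((h l).1 rfl).2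
        · exact h1
      · right
        ext l
        by_cases hl : l = b
        · subst hl; simpa using h1
        · rcases (h l).2 with h2 | ⟨rfl | rfl, h2⟩
          · simp [hl, h2]
          · simp [hl, ((h l).1 rfl).2]
          · exact absurd rfl hl
    rcases ((h k).1 rfl).1 with hk | hk
    · exact Or.inl ⟨hk, aux i j hij hk h⟩
    · refine Or.inr ⟨hk, aux j i hij.symm hk fun l => ?_⟩
      simpa only [or_comm (a := l = j)] using h l
  · rintro (⟨rfl, rfl | rfl⟩ | ⟨rfl, rfl | rfl⟩) l
    · exact ⟨fun h => ⟨Or.inl h, rfl⟩, Or.inl rfl⟩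
    · by_cases hl : l = j
      · subst hl; simp [hij.symm]
      · simp [hl]
    · exact ⟨fun h => ⟨Or.inr h, rfl⟩, Or.inl rfl⟩
    · by_cases hl : l = i
      · subst hl; simp [hij]
      · simp [hl]

theorem incident_plaquette_iff (f : Ridge d) {z : Fin d → ℤ} {i j : Fin d} (hij : i ≠ j)
    (hf : f.1 = (squareAt z i j).dual) (e : Edge d) :
    f.1.Incident e.plaquette.1 ↔ e.1.points ⊆ (squareAt z i j).points := by
  rw [hf]
  exact Facet.incident_dual_iff (by rw [e.2, dim_squareAt z hij]; norm_num)

/-- Plaquettes dual to distinct edges of a common square are adjacent. -/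
theorem plaquetteGraph_adj {e e' : Edge d} (hne : e ≠ e') (z : Fin d → ℤ) {i j : Fin d}
    (hij : i ≠ j) (h : e.1.points ⊆ (squareAt z i j).points)
    (h' : e'.1.points ⊆ (squareAt z i j).points) :
    (plaquetteGraph d).Adj e.plaquette e'.plaquette := by
  have h1 := (squareAt z i j).dim_dual_add_dim
  rw [dim_squareAt z hij] at h1
  refine ⟨fun h2 => hne (plaquette_injective h2), ⟨(squareAt z i j).dual, h1⟩, ?_, ?_⟩
  · exact (incident_plaquette_iff _ hij rfl e).2 h
  · exact (incident_plaquette_iff _ hij rfl e').2 h'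

/-! ### Edge cuts -/

/-- The plaquettes dual to the edges with exactly one endvertex in `A`. -/
def cutPlaquettes (A : Set (Fin d → ℤ)) : Set (Plaquette d) :=
  {π | ∃ x i, π = (edgeAt x i).plaquette ∧ Xor (x ∈ A) (x + unitVec i ∈ A)}

theorem edgeAt_inj {x y : Fin d → ℤ} {i j : Fin d} :
    edgeAt x i = edgeAt y j ↔ x = y ∧ i = j := by
  simp [edgeAt, Subtype.ext_iff, Facet.ext_iff]

theorem plaquette_mem_cutPlaquettes {A : Set (Fin d → ℤ)} (x : Fin d → ℤ) (i : Fin d) :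
    (edgeAt x i).plaquette ∈ cutPlaquettes A ↔ Xor (x ∈ A) (x + unitVec i ∈ A) := by
  constructor
  · rintro ⟨y, j, h, h'⟩
    obtain ⟨rfl, rfl⟩ := edgeAt_inj.1 (plaquette_injective h)
    exact h'
  · exact fun h => ⟨x, i, rfl, h⟩

/-- An edge cut of the lattice has empty boundary. -/
theorem boundary_cutPlaquettes (A : Set (Fin d → ℤ)) : boundary (cutPlaquettes A) = ∅ := by
  classical
  refine Set.eq_empty_iff_forall_notMem.2 fun f hf => ?_
  obtain ⟨z, i, j, hij, hfz⟩ := exists_eq_dual_squareAt f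
  have hne : ∀ k : Fin d, z ≠ z + unitVec k := fun k h => by simp [unitVec] at h
  -- The plaquettes incident to the ridge are dual to the four edges of its square, so the count is
  -- a finite sum of four indicators.
  have hset : {π ∈ cutPlaquettes A | f.1.Incident π.1} = Edge.plaquette ''
      ((({edgeAt z i, edgeAt z j, edgeAt (z + unitVec j) i, edgeAt (z + unitVec i) j} :
        Finset (Edge d)).filter fun e => e.plaquette ∈ cutPlaquettes A : Finset (Edge d)) :
        Set (Edge d)) := by
    ext π
    obtain ⟨e, rfl⟩ := plaquette_surjective π
    obtain ⟨x, k, rfl⟩ := exists_eq_edgeAt e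
    rw [plaquette_injective.mem_set_image]
    simp only [Set.mem_ofPred_eq, incident_plaquette_iff f hij hfz,
      edgeAt_subset_squareAt_iff x z hij k, Finset.coe_filter, Finset.mem_insert,
      Finset.mem_singleton, edgeAt_inj]
    tauto
  have h2 : Odd {π ∈ cutPlaquettes A | f.1.Incident π.1}.ncard := hf
  rw [hset, Set.ncard_image_of_injective _ plaquette_injective, Set.ncard_coe_finset,
    Finset.card_filter, Finset.sum_insert, Finset.sum_insert, Finset.sum_insert,
    Finset.sum_singleton] at h2
  · simp only [plaquette_mem_cutPlaquettes, add_right_comm z (unitVec j) (unitVec i)] at h2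
    -- Membership in `A` changes an even number of times around the four corners.
    by_cases h3 : z ∈ A <;> by_cases h4 : z + unitVec i ∈ A <;> by_cases h5 : z + unitVec j ∈ A <;>
      by_cases h6 : z + unitVec i + unitVec j ∈ A <;> simp [h3, h4, h5, h6] at h2 <;>
      revert h2 <;> decide
  all_goals simp [edgeAt_inj, hij, hij.symm]

/-! ### Oriented paths and their cuts -/

namespace IsOrientedPath

variable {v : ℕ → Fin d → ℤ}

/-- The coordinate sum acts as a clock: it determines the index of a vertex on the path. -/
theorem sum_eq (hv : IsOrientedPath v) (n : ℕ) : ∑ i, v n i = ∑ i, v 0 i + n := by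
  induction n with
  | zero => simp
  | succ n ih =>
    obtain ⟨i, hi⟩ := hv n
    rw [hi]
    simp [Finset.sum_add_distrib, ih, add_assoc]

theorem injective (hv : IsOrientedPath v) : Function.Injective v := by
  intro m n h
  have h1 := hv.sum_eq m
  have h2 := hv.sum_eq n
  rw [h] at h1
  omega

theorem monotone (hv : IsOrientedPath v) : Monotone v := by
  refine monotone_nat_of_le_succ fun n => ?_
  obtain ⟨i, hi⟩ := hv n
  rw [hi]
  exact le_add_of_nonneg_right (by simp [Pi.single_nonneg])

/-- Two vertices of an oriented path that differ by a unit vector are consecutive. -/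
theorem eq_succ_of_eq_add (hv : IsOrientedPath v) {m n : ℕ} {c : Fin d}
    (h : v m = v n + unitVec c) : m = n + 1 := by
  have h1 := hv.sum_eq m
  have h2 := hv.sum_eq n
  rw [h] at h1
  simp [Finset.sum_add_distrib] at h1
  omega

/-- Every vertex off an oriented path lies on an infinite path avoiding it. -/
theorem exists_path_avoiding (hv : IsOrientedPath v) (hd : 2 ≤ d) {y : Fin d → ℤ}
    (hy : y ∉ Set.range v) :
    ∃ γ : ℕ → Fin d → ℤ, Function.Injective γ ∧ (∀ n, LatticeAdj (γ n) (γ (n + 1))) ∧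
      y ∈ Set.range γ ∧ ∀ n, γ n ∉ Set.range v := by
  -- The escape route is a ray in a negative coordinate direction. Below the level of `v 0` any
  -- direction works. Otherwise compare `y` with the path vertex `v m` on its level: some coordinate
  -- `i` has `v m i < y i`. A ray in a direction `j ≠ i` keeps coordinate `i` fixed while its level
  -- drops, whereas by monotonicity the path at lower levels stays at or below `v m i`.
  have key : ∃ j : Fin d, ∀ k : ℕ, (y - (k : ℤ) • unitVec j) ∉ Set.range v := by
    have hs : ∀ (j : Fin d) (k : ℕ), ∑ i, (y - (k : ℤ) • unitVec j) i = ∑ i, y i - k := by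
      intro j k
      simp [Finset.sum_sub_distrib, ← Finset.mul_sum]
    by_cases hlev : ∑ i, y i < ∑ i, v 0 i
    · refine ⟨⟨0, by omega⟩, ?_⟩
      rintro k ⟨m, hm⟩
      have h1 := hv.sum_eq m
      rw [hm, hs] at h1
      omega
    · obtain ⟨m, hm⟩ : ∃ m : ℕ, ∑ i, y i = ∑ i, v 0 i + m :=
        ⟨(∑ i, y i - ∑ i, v 0 i).toNat, by omega⟩
      have hlt : ∃ i, v m i < y i := by
        by_contra! hle
        apply hy
        refine ⟨m, ?_⟩
        ext i
        have h3 : ∑ i, y i = ∑ i, v m i := by rw [hv.sum_eq, hm]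
        exact ((Finset.sum_eq_sum_iff_of_le fun i _ => hle i).1 h3 i (Finset.mem_univ i)).symm
      obtain ⟨i, hi⟩ := hlt
      obtain ⟨j, hj⟩ : ∃ j : Fin d, j ≠ i := by
        have : Nontrivial (Fin d) := Fin.nontrivial_iff_two_le.2 hd
        exact exists_ne i
      refine ⟨j, ?_⟩
      rintro k ⟨l, hl⟩
      have h1 := hv.sum_eq l
      rw [hl, hs] at h1
      have h2 : l ≤ m := by omega
      have h3 := hv.monotone h2 i
      rw [hl] at h3
      simp [hj.symm] at h3
      omega
  obtain ⟨j, hj⟩ := key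
  refine ⟨fun k => y - (k : ℤ) • unitVec j, ?_, ?_, ⟨0, by simp⟩, hj⟩
  · intro k l h
    have := congrFun h j
    simpa using this
  · intro n
    rw [latticeAdj_iff]
    refine ⟨j, Or.inr ?_⟩
    ext l
    simp only [Pi.sub_apply, Pi.add_apply, Pi.smul_apply, smul_eq_mul]
    push_cast
    ring

theorem boundaryPlaquettes_eq (hv : IsOrientedPath v) (hd : 2 ≤ d) :
    boundaryPlaquettes (Set.range v) = cutPlaquettes (Set.range v) := by
  ext π
  constructor
  · rintro ⟨e, rfl, x, hx, y, hy, he⟩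
    obtain ⟨z, i, rfl⟩ := exists_eq_edgeAt e
    rw [plaquette_mem_cutPlaquettes]
    rw [points_edgeAt, Set.pair_eq_pair_iff] at he
    rcases he with ⟨rfl, rfl⟩ | ⟨rfl, rfl⟩
    · exact Or.inl ⟨hx, hy.1⟩
    · exact Or.inr ⟨hx, hy.1⟩
  · rintro ⟨x, i, rfl, h⟩
    have ext : ∀ a b : Fin d → ℤ, a ∈ Set.range v → b ∉ Set.range v → LatticeAdj a b →
        b ∈ externalBoundary (Set.range v) := fun a b ha hb hab =>
      ⟨hb, ⟨a, ha, hab⟩, hv.exists_path_avoiding hd hb⟩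
    have hp := points_edgeAt x i
    rcases h with ⟨h1, h2⟩ | ⟨h1, h2⟩
    · exact ⟨_, rfl, x, h1, _, ext _ _ h1 h2 ⟨_, hp⟩, hp⟩
    · rw [Set.pair_comm] at hp
      exact ⟨_, rfl, _, h1, x, ext _ _ h1 h2 ⟨_, hp⟩, hp⟩

theorem plaquette_add_mem_iff (hv : IsOrientedPath v) {a : ℕ → Fin d}
    (ha : ∀ n, v (n + 1) = v n + unitVec (a n)) (n : ℕ) (c : Fin d) :
    (edgeAt (v n) c).plaquette ∈ cutPlaquettes (Set.range v) ↔ c ≠ a n := by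
  have h1 : v n ∈ Set.range v := ⟨n, rfl⟩
  have h2 : v n + unitVec c ∈ Set.range v ↔ c = a n := by
    constructor
    · rintro ⟨m, hm⟩
      obtain rfl := hv.eq_succ_of_eq_add hm
      rw [ha, add_right_inj] at hm
      by_contra hne
      have := congrFun hm c
      simp [unitVec, hne] at this
    · rintro rfl
      exact ⟨n + 1, ha n⟩
  rw [plaquette_mem_cutPlaquettes, h2]
  simp [h1, Xor]

theorem plaquette_sub_mem_iff (hv : IsOrientedPath v) {a : ℕ → Fin d}
    (ha : ∀ n, v (n + 1) = v n + unitVec (a n)) (n : ℕ) (c : Fin d) :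
    (edgeAt (v n - unitVec c) c).plaquette ∈ cutPlaquettes (Set.range v) ↔
      ∀ m, n = m + 1 → c ≠ a m := by
  have h1 : v n ∈ Set.range v := ⟨n, rfl⟩
  have h2 : v n - unitVec c ∈ Set.range v ↔ ∃ m, n = m + 1 ∧ c = a m := by
    constructor
    · rintro ⟨m, hm⟩
      have hm' : v n = v m + unitVec c := by rw [hm, sub_add_cancel]
      obtain rfl := hv.eq_succ_of_eq_add hm'
      refine ⟨m, rfl, ?_⟩
      rw [ha, add_right_inj] at hm'
      by_contra hne
      have := congrFun hm' c
      simp [unitVec, hne] at this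
    · rintro ⟨m, rfl, rfl⟩
      exact ⟨m, by rw [ha]; simp⟩
  rw [plaquette_mem_cutPlaquettes, sub_add_cancel, h2]
  simp [h1, Xor]

/-- Every cut edge has the form `edgeAt (v n) c` or `edgeAt (v n - unitVec c) c`. Each is linked,
through a common square, to a cut edge at the same or an earlier vertex, and so finally to the edge
entering `v 0` in direction `a 0`. -/
theorem connected_cutPlaquettes (hv : IsOrientedPath v) (hd : 2 ≤ d) :
    ((plaquetteGraph d).induce (cutPlaquettes (Set.range v))).Connected := by
  have : Nontrivial (Fin d) := Fin.nontrivial_iff_two_le.2 hd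
  choose a ha using hv
  have hv : IsOrientedPath v := fun n => ⟨a n, ha n⟩
  have ha' : ∀ n, v (n + 1) = v n + unitVec (a n) := ha
  set P := cutPlaquettes (Set.range v) with hP
  have hplus := hv.plaquette_add_mem_iff ha
  have hminus := hv.plaquette_sub_mem_iff ha
  have h0 : (edgeAt (v 0 - unitVec (a 0)) (a 0)).plaquette ∈ P := (hminus 0 (a 0)).2 (by simp)
  let C : Plaquette d → Prop := fun π => ∃ h : π ∈ P,
    ((plaquetteGraph d).induce P).Reachable ⟨_, h0⟩ ⟨π, h⟩
  have step : ∀ {x y z : Fin d → ℤ} {k l i j : Fin d}, i ≠ j →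
      ((k = i ∧ (x = z ∨ x = z + unitVec j)) ∨ (k = j ∧ (x = z ∨ x = z + unitVec i))) →
      ((l = i ∧ (y = z ∨ y = z + unitVec j)) ∨ (l = j ∧ (y = z ∨ y = z + unitVec i))) →
      C (edgeAt x k).plaquette → (edgeAt y l).plaquette ∈ P → C (edgeAt y l).plaquette := by
    rintro x y z k l i j hij hx hy ⟨h, hr⟩ h'
    refine ⟨h', ?_⟩
    by_cases hne : edgeAt x k = edgeAt y l
    · simpa only [hne] using hr
    · refine hr.trans (SimpleGraph.Adj.reachable ?_)
      exact plaquetteGraph_adj hne z hij ((edgeAt_subset_squareAt_iff x z hij k).2 hx)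
        ((edgeAt_subset_squareAt_iff y z hij l).2 hy)
  have key : ∀ n, (∀ c, (edgeAt (v n) c).plaquette ∈ P → C (edgeAt (v n) c).plaquette) ∧
      ∀ c, (edgeAt (v n - unitVec c) c).plaquette ∈ P →
        C (edgeAt (v n - unitVec c) c).plaquette := by
    intro n
    induction n using Nat.strong_induction_on with
    | _ n ih =>
    rcases n with _ | n
    · have hC : C (edgeAt (v 0 - unitVec (a 0)) (a 0)).plaquette := ⟨h0, .refl _⟩
      refine ⟨fun c hc => ?_, fun c hc => ?_⟩
      · have hca := (hplus 0 c).1 hc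
        refine step (z := v 0 - unitVec (a 0)) (i := c) (j := a 0) hca ?_ ?_ hC hc
        · exact Or.inr ⟨rfl, Or.inl rfl⟩
        · exact Or.inl ⟨rfl, Or.inr (by simp)⟩
      · by_cases hca : c = a 0
        · rwa [hca]
        · refine step (z := v 0 - unitVec (a 0) - unitVec c) (i := c) (j := a 0) hca ?_ ?_ hC hc
          · exact Or.inr ⟨rfl, Or.inr (by simp)⟩
          · exact Or.inl ⟨rfl, Or.inr (by abel)⟩
    · have hm : ∀ c, (edgeAt (v (n + 1) - unitVec c) c).plaquette ∈ P →
          C (edgeAt (v (n + 1) - unitVec c) c).plaquette := by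
        intro c hc
        have hca : c ≠ a n := (hminus (n + 1) c).1 hc n rfl
        by_cases hprev : (edgeAt (v n - unitVec c) c).plaquette ∈ P
        · refine step (z := v n - unitVec c) (i := c) (j := a n) hca ?_ ?_
            ((ih n (Nat.lt_succ_self n)).2 c hprev) hc
          · exact Or.inl ⟨rfl, Or.inl rfl⟩
          · exact Or.inl ⟨rfl, Or.inr (by rw [ha']; abel)⟩
        -- The parallel edge at the previous vertex is missing only if the path itself arrived
        -- through it. The square of the last two steps then leads to a cut edge two vertices back,
        -- hence the strong induction.
        · rw [hminus] at hprev
          push Not at hprev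
          obtain ⟨m, rfl, rfl⟩ := hprev
          have h1 := (ih m (by omega)).1 (a (m + 1)) ((hplus m _).2 hca.symm)
          refine step (z := v m) (i := a m) (j := a (m + 1)) hca ?_ ?_ h1 hc
          · exact Or.inr ⟨rfl, Or.inl rfl⟩
          · exact Or.inl ⟨rfl, Or.inr (by rw [ha', ha']; abel)⟩
      refine ⟨fun c hc => ?_, hm⟩
      have hcb := (hplus (n + 1) c).1 hc
      -- If the path goes straight into `v (n + 1)` along `c`, the parallel edge at `v n` does not
      -- exist in the cut; the incoming edge in direction `a (n + 1) ≠ c` replaces it.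
      by_cases hca : c = a n
      · have hb : (edgeAt (v (n + 1) - unitVec (a (n + 1))) (a (n + 1))).plaquette ∈ P := by
          rw [hminus]
          intro m hmn
          obtain rfl : n = m := by omega
          rw [← hca]
          exact hcb.symm
        refine step (z := v (n + 1) - unitVec (a (n + 1))) (i := c) (j := a (n + 1)) hcb ?_ ?_
          (hm _ hb) hc
        · exact Or.inr ⟨rfl, Or.inl rfl⟩
        · exact Or.inl ⟨rfl, Or.inr (by simp)⟩
      · refine step (z := v n) (i := c) (j := a n) hca ?_ ?_
          ((ih n (Nat.lt_succ_self n)).1 c ((hplus n c).2 hca)) hc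
        · exact Or.inl ⟨rfl, Or.inl rfl⟩
        · exact Or.inl ⟨rfl, Or.inr (ha' n)⟩
  have all : ∀ π ∈ P, C π := by
    intro π hπ
    obtain ⟨x, i, rfl, h⟩ := id hπ
    rcases h with ⟨⟨n, rfl⟩, -⟩ | ⟨⟨n, hn⟩, -⟩
    · exact (key n).1 i hπ
    · obtain rfl : x = v n - unitVec i := by rw [hn]; simp
      exact (key n).2 i hπ
  refine (SimpleGraph.connected_iff_exists_forall_reachable _).2 ⟨⟨_, h0⟩, ?_⟩
  rintro ⟨π, hπ⟩
  exact (all π hπ).2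

theorem infinite_cutPlaquettes (hv : IsOrientedPath v) (hd : 2 ≤ d) :
    (cutPlaquettes (Set.range v)).Infinite := by
  have : Nontrivial (Fin d) := Fin.nontrivial_iff_two_le.2 hd
  choose a ha using id hv
  choose c hc using fun n => exists_ne (a n)
  refine Set.infinite_of_injective_forall_mem (f := fun n => (edgeAt (v n) (c n)).plaquette) ?_
    fun n => (hv.plaquette_add_mem_iff ha n (c n)).2 (hc n)
  intro m n h
  exact hv.injective (edgeAt_inj.1 (plaquette_injective h)).1

end IsOrientedPath

/-! ### Good cubes -/

/-- The edges incident to `x`. -/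
def starEdge (x : Fin d → ℤ) (s : Fin d × Bool) : Edge d :=
  edgeAt (if s.2 then x else x - unitVec s.1) s.1

theorem mem_points_edge_iff (x : Fin d → ℤ) (e : Edge d) :
    x ∈ e.1.points ↔ ∃ s, e = starEdge x s := by
  obtain ⟨y, i, rfl⟩ := exists_eq_edgeAt e
  rw [points_edgeAt, Set.mem_insert_iff, Set.mem_singleton_iff]
  constructor
  · rintro (rfl | rfl)
    · exact ⟨(i, true), rfl⟩
    · exact ⟨(i, false), by simp [starEdge]⟩
  · rintro ⟨⟨j, _ | _⟩, h⟩
    · obtain ⟨rfl, rfl⟩ := edgeAt_inj.1 h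
      simp
    · exact Or.inl (edgeAt_inj.1 h).1.symm

theorem cubeAt_incident_iff (x : Fin d → ℤ) (e : Edge d) :
    (cubeAt x).Incident e.plaquette.1 ↔ x ∈ e.1.points := by
  refine (Facet.incident_dual_iff' (G := ⟨x, ∅⟩) (F := e.1) ?_).trans ?_
  · rw [e.2]; simp [Facet.dim]
  · have h : (⟨x, ∅⟩ : Facet d).points = {x} := by
      ext y
      simp [Facet.points, funext_iff]
    rw [h, Set.singleton_subset_iff]

theorem good_cubeAt_iff (ω : Config d) (x : Fin d → ℤ) :
    Good ω (cubeAt x) ↔ ∀ s, ω (starEdge x s) = false := by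
  have hopen : ∀ e : Edge d, PlaquetteOpen ω e.plaquette ↔ ω e = false := fun e =>
    ⟨fun ⟨e', h, h'⟩ => plaquette_injective h ▸ h', fun h => ⟨e, rfl, h⟩⟩
  simp only [Good, plaquette_surjective.forall, cubeAt_incident_iff, mem_points_edge_iff, hopen]
  exact ⟨fun h s => h _ ⟨s, rfl⟩, fun h e ⟨s, hs⟩ => hs ▸ h s⟩

theorem plaquetteOpen_of_good {ω : Config d} {A : Set (Fin d → ℤ)}
    (h : ∀ x ∈ A, Good ω (cubeAt x)) : ∀ π ∈ cutPlaquettes A, PlaquetteOpen ω π := by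
  rintro π ⟨x, i, rfl, hx | hx⟩
  · exact h _ hx.1 _ ((cubeAt_incident_iff _ _).2 (by simp [points_edgeAt]))
  · exact h _ hx.1 _ ((cubeAt_incident_iff _ _).2 (by simp [points_edgeAt]))

/-! ### The border of the reachable region -/

/-- The sites of `ℤ²` reachable from the half plane `y ≤ x` by steps to the right, steps down, and
diagonal steps `(-1, 1)` that end in a site of `B`. -/
inductive Reach (B : ℤ × ℤ → Prop) : ℤ × ℤ → Prop
  | base (x y : ℤ) : y ≤ x → Reach B (x, y)
  | right (x y : ℤ) : Reach B (x, y) → Reach B (x + 1, y)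
  | down (x y : ℤ) : Reach B (x, y) → Reach B (x, y - 1)
  | up (x y : ℤ) : Reach B (x, y) → B (x - 1, y + 1) → Reach B (x - 1, y + 1)

/-- If some site is not reachable, then the border of the reachable region contains an infinite
oriented path that avoids `B`. -/
theorem exists_staircase {B : ℤ × ℤ → Prop} {n : ℕ} (h : ¬ Reach B (-n, n)) :
    ∃ w : ℕ → ℤ × ℤ, (∀ k, ¬ B (w k)) ∧
      ∀ k, w (k + 1) = w k + (1, 0) ∨ w (k + 1) = w k + (0, 1) := by
  classical
  -- The antidiagonal from `(-n, n)` ends at the origin, which is reachable, so it crosses the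
  -- border.
  have hstart : ∃ q : ℤ × ℤ, ¬ Reach B q ∧ Reach B (q + (1, -1)) := by
    by_contra! hall
    have : ∀ k : ℕ, ¬ Reach B (-n + k, n - k) := by
      intro k
      induction k with
      | zero => simpa using h
      | succ k ih =>
        have := hall _ ih
        simp only [Prod.mk_add_mk] at this
        push_cast
        rwa [← add_assoc, ← sub_sub]
    exact this n (.base _ _ (by simp))
  let S := {q : ℤ × ℤ // ¬ Reach B q ∧ Reach B (q + (1, -1))}
  -- Closure under right and down steps makes one of the two candidates a border site again.
  have hnext : ∀ q : S, ∃ r : S, r.1 = q.1 + (1, 0) ∨ r.1 = q.1 + (0, 1) := by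
    rintro ⟨⟨x, y⟩, h1, h2⟩
    by_cases hr : Reach B (x + 1, y)
    · refine ⟨⟨(x, y + 1), fun h3 => h1 ?_, ?_⟩, Or.inr (by simp)⟩
      · simpa using h3.down
      · simpa using hr
    · refine ⟨⟨(x + 1, y), hr, ?_⟩, Or.inl (by simp)⟩
      simpa using h2.right
  choose next hnext using hnext
  obtain ⟨q, hq⟩ := hstart
  let w : ℕ → S := fun k => next^[k] ⟨q, hq⟩
  refine ⟨fun k => (w k).1, fun k hB => ?_, fun k => ?_⟩
  -- A border site in `B` would be reachable by the diagonal step from its neighbour `q + (1, -1)`.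
  · have h2 := (w k).2
    dsimp only at hB
    generalize (w k).1 = z at h2 hB
    obtain ⟨x, y⟩ := z
    apply h2.1
    have h3 := h2.2
    simp only [Prod.mk_add_mk] at h3
    have := Reach.up (B := B) _ _ h3 (by simpa using hB)
    simpa using this
  · simp only [w, Function.iterate_succ_apply']
    exact hnext _

/-! ### Self-avoiding walks back to the half plane -/

/-- Reversed steps: from the end of a step to its start. -/
def backStep : Fin 3 → ℤ × ℤ := ![(-1, 0), (0, 1), (1, -1)]

/-- The sites visited by the walk that starts at a given site and follows a word of reversed
steps. -/
def visited : ℤ × ℤ → List (Fin 3) → List (ℤ × ℤ)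
  | q, [] => [q]
  | q, s :: w => q :: visited (q + backStep s) w

/-- The last site visited. -/
def walkEnd : ℤ × ℤ → List (Fin 3) → ℤ × ℤ
  | q, [] => q
  | q, s :: w => walkEnd (q + backStep s) w

/-- The sites that a walk leaves by a reversed diagonal step. -/
def diagonals : ℤ × ℤ → List (Fin 3) → List (ℤ × ℤ)
  | _, [] => []
  | q, s :: w => (if s = 2 then [q] else []) ++ diagonals (q + backStep s) w

theorem diagonals_sublist (q : ℤ × ℤ) (w : List (Fin 3)) :
    (diagonals q w).Sublist (visited q w) := by
  induction w generalizing q with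
  | nil => simp [diagonals]
  | cons s w ih =>
    simp only [diagonals, visited]
    split_ifs
    · exact (ih _).cons_cons _
    · exact (ih _).cons _

theorem length_diagonals_le (q : ℤ × ℤ) (w : List (Fin 3)) :
    (diagonals q w).length ≤ w.length := by
  induction w generalizing q with
  | nil => simp [diagonals]
  | cons s w ih =>
    have := ih (q + backStep s)
    simp only [diagonals, List.length_append, List.length_cons]
    split_ifs <;> simp <;> omega

/-- The height `y - x` rises by 1 along a straight reversed step and drops by 2 along a diagonal
one. -/
theorem walkEnd_height (q : ℤ × ℤ) (w : List (Fin 3)) :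
    q.2 - q.1 + w.length =
      (walkEnd q w).2 - (walkEnd q w).1 + 3 * (diagonals q w).length := by
  induction w generalizing q with
  | nil => simp [diagonals, walkEnd]
  | cons s w ih =>
    have := ih (q + backStep s)
    fin_cases s <;> simp [diagonals, walkEnd, backStep] at this ⊢ <;> omega

theorem exists_suffix {q r : ℤ × ℤ} {w : List (Fin 3)} (h : r ∈ visited q w) :
    ∃ w', (visited r w').Sublist (visited q w) ∧ (diagonals r w').Sublist (diagonals q w) ∧
      walkEnd r w' = walkEnd q w := by
  induction w generalizing q with
  | nil =>
    obtain rfl : r = q := by simpa [visited] using h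
    exact ⟨[], .refl _, .refl _, rfl⟩
  | cons s w ih =>
    rw [visited, List.mem_cons] at h
    rcases h with rfl | h
    · exact ⟨s :: w, .refl _, .refl _, rfl⟩
    · obtain ⟨w', h1, h2, h3⟩ := ih h
      exact ⟨w', h1.cons _, h2.trans (List.sublist_append_right _ _), h3⟩

/-- Reverse the steps that reach `q`, erasing loops on the way. The sites left by reversed diagonals
are the ends of diagonal steps, so they lie in `B`. -/
theorem Reach.exists_word {B : ℤ × ℤ → Prop} {q : ℤ × ℤ} (h : Reach B q) :
    ∃ w : List (Fin 3), (visited q w).Nodup ∧ (∀ r ∈ diagonals q w, B r) ∧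
      (walkEnd q w).2 ≤ (walkEnd q w).1 := by
  have step : ∀ (q r : ℤ × ℤ) (s : Fin 3), q = r + backStep s → (s = 2 → B r) →
      (∃ w : List (Fin 3), (visited q w).Nodup ∧ (∀ r ∈ diagonals q w, B r) ∧
        (walkEnd q w).2 ≤ (walkEnd q w).1) →
      ∃ w : List (Fin 3), (visited r w).Nodup ∧ (∀ t ∈ diagonals r w, B t) ∧
        (walkEnd r w).2 ≤ (walkEnd r w).1 := by
    rintro q r s rfl hs ⟨w, h1, h2, h3⟩
    by_cases hr : r ∈ visited (r + backStep s) w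
    · obtain ⟨w', h4, h5, h6⟩ := exists_suffix hr
      exact ⟨w', h4.nodup h1, fun t ht => h2 t (h5.subset ht), by rwa [h6]⟩
    · refine ⟨s :: w, List.nodup_cons.2 ⟨hr, h1⟩, fun t ht => ?_, h3⟩
      rw [diagonals, List.mem_append] at ht
      rcases ht with ht | ht
      · split_ifs at ht with hs2
        · obtain rfl : t = r := by simpa using ht
          exact hs hs2
        · simp at ht
      · exact h2 t ht
  induction h with
  | base x y h => exact ⟨[], by simp [visited], by simp [diagonals], h⟩
  | right x y _ ih => exact step _ _ 0 (by simp [backStep]) (by simp) ih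
  | down x y _ ih => exact step _ _ 1 (by simp [backStep]) (by simp) ih
  | up x y _ hB ih => exact step _ _ 2 (by simp [backStep]) (fun _ => hB) ih

/-- A site of height `2 * n` is reachable only through many distinct sites of `B`. -/
theorem Reach.exists_long_word {B : ℤ × ℤ → Prop} {n : ℕ} (h : Reach B (-n, n)) :
    ∃ w : List (Fin 3), n ≤ w.length ∧ (diagonals (-n, n) w).Nodup ∧
      w.length ≤ 3 * (diagonals (-n, n) w).length ∧ ∀ r ∈ diagonals (-n, n) w, B r := by
  obtain ⟨w, h1, h2, h3⟩ := h.exists_word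
  -- The height goes from `2 * n` to at most 0, so with `D` diagonals `2 * n + w.length ≤ 3 * D ≤ 3
  -- * w.length`; both length bounds follow.
  have h4 := walkEnd_height (-n, n) w
  have h5 := length_diagonals_le (-n, n) w
  simp only at h4
  exact ⟨w, by omega, (diagonals_sublist _ _).nodup h1, by omega, h2⟩

/-! ### The Peierls estimate -/

/-- The probability that all edges of a finite set are open. -/
theorem bondMeasure_forall_open (p : I) (E : Finset (Edge d)) :
    bondMeasure d p {ω | ∀ e ∈ E, ω e = true} = ENNReal.ofReal p ^ E.card := by
  have h : {ω : Config d | ∀ e ∈ E, ω e = true} = (E : Set (Edge d)).pi fun _ => {true} := by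
    ext ω
    simp [Set.mem_pi]
  rw [h, bondMeasure, Measure.infinitePi_pi _ fun _ _ => measurableSet_singleton _]
  have h1 : (bernoulliMeasure true false p) {true} = ENNReal.ofReal p := by
    rw [bernoulliMeasure_apply_of_mem_of_notMem p (measurableSet_singleton _) (by simp) (by simp),
      ENNReal.ofReal_eq_coe_nnreal p.2.1]
    rfl
  simp [h1]

/-- The probability that no cube of a finite set is good. -/
theorem bondMeasure_forall_not_good {p : I} {r : ENNReal} (hr : r ≤ 1)
    (hp : ENNReal.ofReal p ≤ r ^ 6) (T : Finset (Fin d → ℤ)) {N : ℕ} (hN : N ≤ 3 * T.card)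
    (hT : T.card ≤ N) (hd : 1 ≤ d) :
    bondMeasure d p {ω | ∀ x ∈ T, ¬ Good ω (cubeAt x)} ≤ (2 * d * r) ^ N := by
  classical
  -- Choose an open edge at each site of `T`; the union bound runs over the choices `f`.
  have hsub : {ω : Config d | ∀ x ∈ T, ¬ Good ω (cubeAt x)} ⊆
      ⋃ f : T → Fin d × Bool,
        {ω | ∀ e ∈ Finset.univ.image fun x : T => starEdge x.1 (f x), ω e = true} := by
    intro ω hω
    have : ∀ x : T, ∃ s, ω (starEdge x.1 s) = true := by
      intro x
      have := hω x.1 x.2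
      rw [good_cubeAt_iff] at this
      push Not at this
      simpa only [Bool.not_eq_false, ne_eq] using this
    choose f hf using this
    exact Set.mem_iUnion.2 ⟨f, Finset.forall_mem_image.2 fun x _ => hf x⟩
  have hone : ∀ f : T → Fin d × Bool, bondMeasure d p
      {ω | ∀ e ∈ Finset.univ.image fun x : T => starEdge x.1 (f x), ω e = true} ≤ r ^ N := by
    intro f
    rw [bondMeasure_forall_open]
    -- An edge has two endvertices, so it is chosen at most twice. With `N ≤ 3 * T.card` this gives
    -- at least `N / 6` distinct edges, which is why `p` is compared with `r ^ 6`.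
    have hcard : T.card ≤ 2 * (Finset.univ.image fun x : T => starEdge x.1 (f x)).card := by
      rw [← Fintype.card_coe T, ← Finset.card_univ]
      refine Finset.card_le_mul_card_image _ _ fun e _ => ?_
      obtain ⟨y, i, rfl⟩ := exists_eq_edgeAt e
      refine le_trans (Finset.card_le_card_of_injOn (t := {y, y + unitVec i}) Subtype.val ?_
        Subtype.val_injective.injOn) Finset.card_le_two
      intro x hx
      have h1 : x.1 ∈ (edgeAt y i).1.points :=
        (mem_points_edge_iff _ _).2 ⟨f x, (Finset.mem_filter.1 hx).2.symm⟩
      simpa [points_edgeAt] using h1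
    calc _ ≤ (r ^ 6) ^ (Finset.univ.image fun x : T => starEdge x.1 (f x)).card := by gcongr
      _ = r ^ (6 * _) := (pow_mul _ _ _).symm
      _ ≤ r ^ N := pow_le_pow_right_of_le_one' hr (by omega)
  calc _ ≤ _ := measure_mono hsub
    _ ≤ _ := measure_iUnion_fintype_le _ _
    _ ≤ ∑ _f : T → Fin d × Bool, r ^ N := Finset.sum_le_sum fun f _ => hone f
    _ = (2 * d : ENNReal) ^ T.card * r ^ N := by simp [mul_comm]
    _ ≤ (2 * d : ENNReal) ^ N * r ^ N := by
      gcongr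
      have h : (1 : ENNReal) ≤ d := by exact_mod_cast hd
      calc (1 : ENNReal) ≤ 2 * 1 := by norm_num
        _ ≤ 2 * d := by gcongr
    _ = _ := (mul_pow _ _ _).symm

/-- The embedding of the square lattice as a coordinate plane. -/
def planeEmb (i j : Fin d) (q : ℤ × ℤ) : Fin d → ℤ := Pi.single i q.1 + Pi.single j q.2

theorem planeEmb_injective {i j : Fin d} (hij : i ≠ j) : Function.Injective (planeEmb i j) := by
  intro q r h
  have h1 := congrFun h i
  have h2 := congrFun h j
  simp [planeEmb, hij, hij.symm] at h1 h2
  exact Prod.ext h1 h2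

theorem bondMeasure_reach_le {p : I} {r : ENNReal} (hr : 12 * d * r = 1)
    (hp : ENNReal.ofReal p ≤ r ^ 6) (hd : 1 ≤ d) {i j : Fin d} (hij : i ≠ j) (n : ℕ) :
    bondMeasure d p {ω | Reach (fun q => ¬ Good ω (cubeAt (planeEmb i j q))) (-n, n)} ≤
      2 * (1 / 2) ^ n := by
  classical
  have hr1 : r ≤ 1 := by
    have h : (1 : ENNReal) ≤ d := by exact_mod_cast hd
    calc r = 1 * 1 * r := by simp
      _ ≤ 12 * d * r := by gcongr; norm_num
      _ = 1 := hr
  -- Three letters per step against `2 * d * r` per step: this ratio is the reason for the constant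
  -- 12.
  have h6 : 3 * (2 * d * r) = 1 / 2 := by
    rw [ENNReal.eq_div_iff (by norm_num) (by norm_num), ← hr]
    ring
  -- The first two conditions do not involve `ω`; words violating them give the empty event, so one
  -- bound serves all words.
  let A : (N : ℕ) → List.Vector (Fin 3) N → Set (Config d) := fun N w =>
    {ω | (diagonals (-n, n) w.1).Nodup ∧ N ≤ 3 * (diagonals (-n, n) w.1).length ∧
      ∀ q ∈ diagonals (-n, n) w.1, ¬ Good ω (cubeAt (planeEmb i j q))}
  have hA : ∀ N w, bondMeasure d p (A N w) ≤ (2 * d * r) ^ N := by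
    intro N w
    by_cases h : (diagonals (-n, n) w.1).Nodup ∧ N ≤ 3 * (diagonals (-n, n) w.1).length
    · have hc : ((diagonals (-n, n) w.1).toFinset.image (planeEmb i j)).card =
          (diagonals (-n, n) w.1).length := by
        rw [Finset.card_image_of_injective _ (planeEmb_injective hij),
          List.toFinset_card_of_nodup h.1]
      have h2 := length_diagonals_le (-n, n) w.1
      rw [w.2] at h2
      refine le_trans (measure_mono ?_) (bondMeasure_forall_not_good hr1 hp
        ((diagonals (-n, n) w.1).toFinset.image (planeEmb i j)) (N := N) ?_ ?_ hd)
      · intro ω hω x hx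
        obtain ⟨q, hq, rfl⟩ := Finset.mem_image.1 hx
        exact hω.2.2 q (List.mem_toFinset.1 hq)
      · rw [hc]; exact h.2
      · rw [hc]; exact h2
    · have : A N w = ∅ := Set.eq_empty_iff_forall_notMem.2 fun ω hω => h ⟨hω.1, hω.2.1⟩
      simp [this]
  have hsub : {ω : Config d | Reach (fun q => ¬ Good ω (cubeAt (planeEmb i j q))) (-n, n)} ⊆
      ⋃ k : ℕ, ⋃ w : List.Vector (Fin 3) (n + k), A (n + k) w := by
    intro ω hω
    obtain ⟨w, h1, h2, h3, h4⟩ := Reach.exists_long_word hω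
    obtain ⟨k, hk⟩ := Nat.exists_eq_add_of_le h1
    exact Set.mem_iUnion.2 ⟨k, Set.mem_iUnion.2 ⟨⟨w, hk⟩, h2, hk.symm.trans_le h3, h4⟩⟩
  calc _ ≤ _ := measure_mono hsub
    _ ≤ _ := measure_iUnion_le _
    _ ≤ ∑' k : ℕ, (1 / 2 : ENNReal) ^ n * (1 / 2) ^ k := by
      refine ENNReal.tsum_le_tsum fun k => ?_
      calc _ ≤ _ := measure_iUnion_fintype_le _ _
        _ ≤ ∑ _w : List.Vector (Fin 3) (n + k), (2 * d * r) ^ (n + k) :=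
          Finset.sum_le_sum fun w _ => hA _ w
        _ = (3 * (2 * d * r)) ^ (n + k) := by
          simp [card_vector, mul_pow]
        _ = _ := by rw [h6, pow_add]
    _ = 2 * (1 / 2) ^ n := by
      rw [ENNReal.tsum_mul_left, one_div, ENNReal.tsum_geometric_two, mul_comm]

/-- At low density of open edges there is almost surely an infinite oriented path of good cubes. -/
theorem ae_exists_orientedPath {p : I} {r : ENNReal} (hr : 12 * d * r = 1)
    (hp : ENNReal.ofReal p ≤ r ^ 6) (hd : 2 ≤ d) :
    ∀ᵐ ω ∂(bondMeasure d p), ∃ v : ℕ → Fin d → ℤ, IsOrientedPath v ∧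
      ∀ n, Good ω (cubeAt (v n)) := by
  have : Nontrivial (Fin d) := Fin.nontrivial_iff_two_le.2 hd
  obtain ⟨i, j, hij⟩ := exists_pair_ne (Fin d)
  -- Only upper bounds by monotonicity and subadditivity occur, so the measurability of the `Reach`
  -- events plays no role.
  have hzero : bondMeasure d p
      {ω | ∀ n : ℕ, Reach (fun q => ¬ Good ω (cubeAt (planeEmb i j q))) (-n, n)} = 0 := by
    refine le_antisymm (ge_of_tendsto' (x := Filter.atTop)
      (f := fun n : ℕ => 2 * (1 / 2 : ENNReal) ^ n) ?_ fun n => ?_) bot_le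
    · have h := ENNReal.Tendsto.const_mul (a := 2) (ENNReal.tendsto_pow_atTop_nhds_zero_of_lt_one
        (r := 1 / 2) (by rw [one_div]; exact ENNReal.one_half_lt_one)) (Or.inr (by norm_num))
      simpa using h
    · exact le_trans (measure_mono fun ω hω => hω n)
        (bondMeasure_reach_le hr hp (by omega) hij n)
  filter_upwards [measure_eq_zero_iff_ae_notMem.1 hzero] with ω hω
  simp only [not_forall] at hω
  obtain ⟨n, hn⟩ := hω
  obtain ⟨w, hw, hstep⟩ := exists_staircase hn
  refine ⟨fun k => planeEmb i j (w k), fun k => ?_, fun k => not_not.1 (hw k)⟩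
  rcases hstep k with h | h
  · refine ⟨i, ?_⟩
    simp only [h, planeEmb, Prod.fst_add, Prod.snd_add, Pi.single_add, Pi.single_zero]
    abel
  · refine ⟨j, ?_⟩
    simp only [h, planeEmb, Prod.fst_add, Prod.snd_add, Pi.single_add, Pi.single_zero]
    abel

end PlaquettePercolation

theorem mainTheorem10 (d : ℕ) (hd : 2 ≤ d) :
    0 < PlaquettePercolation.psurf d ∧
    ∃ p' : unitInterval, 0 < p' ∧ ∀ p < p',
      ∀ᵐ ω ∂(PlaquettePercolation.bondMeasure d p),
        ∃ v : ℕ → Fin d → ℤ,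
          PlaquettePercolation.IsOrientedPath v ∧
          (∀ n, PlaquettePercolation.Good ω (PlaquettePercolation.cubeAt (v n))) ∧
          PlaquettePercolation.IsSurface
            (PlaquettePercolation.boundaryPlaquettes (Set.range v)) ∧
          (PlaquettePercolation.boundaryPlaquettes (Set.range v)).Infinite ∧
          ∀ π ∈ PlaquettePercolation.boundaryPlaquettes (Set.range v),
            PlaquettePercolation.PlaquetteOpen ω π := by
  -- The first claim follows from the second: any `p` strictly between 0 and `p'` belongs to the set
  -- whose supremum is `psurf d`.
  refine (and_iff_right_of_imp fun h2 => ?_).2 ?_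
  · obtain ⟨p', hp', h⟩ := h2
    obtain ⟨p, hp, hpp'⟩ := exists_between hp'
    refine hp.trans_le (le_sSup ?_)
    filter_upwards [h p hpp'] with ω ⟨v, _, _, h3, h4, h5⟩
    exact ⟨_, h3, h4, h5⟩
  · have hd1 : (1 : ℝ) ≤ d := by exact_mod_cast (by omega : 1 ≤ d)
    have hr0 : 0 < (12 * d : ℝ)⁻¹ := by positivity
    have hr1 : (12 * d : ℝ)⁻¹ ≤ 1 := inv_le_one_of_one_le₀ (by linarith)
    -- The threshold is `p' = r ^ 6` with `r = 1 / (12 * d)`.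
    refine ⟨⟨(12 * d : ℝ)⁻¹ ^ 6, by positivity, pow_le_one₀ hr0.le hr1⟩,
      Subtype.coe_lt_coe.1 (pow_pos hr0 6), fun p hp => ?_⟩
    have hr : 12 * d * ENNReal.ofReal (12 * d : ℝ)⁻¹ = 1 := by
      have h : (12 * d : ENNReal) = ENNReal.ofReal (12 * d) := by
        rw [ENNReal.ofReal_mul (by norm_num)]
        simp
      rw [h, ← ENNReal.ofReal_mul (by positivity), mul_inv_cancel₀ (by positivity),
        ENNReal.ofReal_one]
    have hp6 : ENNReal.ofReal p ≤ ENNReal.ofReal (12 * d : ℝ)⁻¹ ^ 6 := by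
      rw [← ENNReal.ofReal_pow hr0.le]
      exact ENNReal.ofReal_le_ofReal (Subtype.coe_lt_coe.2 hp).le
    filter_upwards [PlaquettePercolation.ae_exists_orientedPath hr hp6 hd] with ω ⟨v, hv, hgood⟩
    refine ⟨v, hv, hgood, ?_⟩
    rw [hv.boundaryPlaquettes_eq hd]
    refine ⟨⟨hv.connected_cutPlaquettes hd, PlaquettePercolation.boundary_cutPlaquettes _⟩,
      hv.infinite_cutPlaquettes hd, PlaquettePercolation.plaquetteOpen_of_good ?_⟩
    rintro _ ⟨n, rfl⟩
    exact hgood n
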